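/- Let $M=\{c\in\mathbb C:\sup_{n}|f_c^n(0)|<\infty\}$ be the Mandelbrot set of the family $f_c(z)=z^2-c$ (where $f_c^n$ is the $n$-th iterate), let $\varphi:\mathbb C\setminus M\to\mathbb C\setminus\overline{\mathbb D}$ be the conformal isomorphism onto the complement of the closed unit disk normalized by $\varphi(c)/c\to1$ as $c\to\infty$, and let $\psi=\varphi^{-1}:\mathbb C\setminus\overline{\mathbb D}\to\mathbb C\setminus M$ be the inverse (Riemann) map. Consider their Laurent series at $\infty$, $$\varphi(c)=c+B_0+\frac{B_1}{c}+\dots+\frac{B_\ell}{c^\ell}+\dots,\qquad \psi(w)=w+C_0+\frac{C_1}{w}+\dots+\frac{C_\ell}{w^\ell}+\dots .$$ For every odd $\ell\ge 1$ we have $B_\ell=R_\ell/2^{p_\ell}$ and $C_\ell=K_\ell/2^{q_\ell}$ with odd integers $R_\ell,K_\ell$ and integers $p_\ell,q_\ell$ satisfying $$q_\ell=p_\ell=\ell+1+\operatorname{ord}\big((\ell+1)!\big),$$ where $\operatorname{ord}(m)$ is the exponent of the largest power of $2$ that divides the integer $m\neq0$. In particular, $C_\ell\ne0$ if $\ell$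 is odd. -/

import Mathlib

open Filter Topology Bornology

/-- The quadratic family `f_c(z) = z² - c`. -/
def quadFamily (c z : ℂ) : ℂ := z ^ 2 - c

/-- The Mandelbrot set `{c : sup_n |f_c^n(0)| < ∞}` of the family `f_c(z) = z² - c`. -/
def mandelbrotSet : Set ℂ :=
  {c | BddAbove (Set.range fun n : ℕ => ‖(quadFamily c)^[n] 0‖)}

/-- The complement of the closed unit disk. -/
def exteriorDisk : Set ℂ := {w | 1 < ‖w‖}

/-- `f` is a conformal isomorphism (biholomorphic map) from `U` onto `V`, with inverse `g`. -/
structure IsConformalIso (f g : ℂ → ℂ) (U V : Set ℂ) : Prop where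
  holo : DifferentiableOn ℂ f U
  holo_inv : DifferentiableOn ℂ g V
  mapsTo : Set.MapsTo f U V
  mapsTo_inv : Set.MapsTo g V U
  invOn : Set.InvOn g f U V

/-- `φ` is the conformal isomorphism from the complement of the Mandelbrot set onto the complement
of the closed unit disk, normalized by `φ(c) / c → 1` at infinity, and `ψ = φ⁻¹` is the Riemann map
from the complement of the closed unit disk onto the complement of the Mandelbrot set. -/
structure IsMandelbrotRiemannPair (φ ψ : ℂ → ℂ) : Prop where
  conformal : IsConformalIso φ ψ mandelbrotSetᶜ exteriorDisk
  normalized : Tendsto (fun c : ℂ => φ c / c) (cobounded ℂ) (𝓝 1)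

/-- The Laurent series of `f` at infinity is `z + a₀ + a₁ / z + a₂ / z² + ⋯`. -/
def HasLaurentAtInfty (f : ℂ → ℂ) (a : ℕ → ℂ) : Prop :=
  ∀ᶠ z in cobounded ℂ, HasSum (fun l : ℕ => a l / z ^ l) (f z - z)

/-- `x = K / 2 ^ q` for some odd integer `K`; for a given `x` there is at most one such integer
`q`, and `x ≠ 0` if there is one. -/
def HasDyadicExponent (x : ℂ) (q : ℤ) : Prop :=
  ∃ K : ℤ, Odd K ∧ x = (K : ℂ) / (2 : ℂ) ^ q

/-!
Work in the coordinate `x = 1 / c`, with `G(x) = x φ(1 / x)` and `D(u) = u ψ(1 / u)`; the claim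
concerns the Taylor coefficients of `G` and `D` at `0` of even order `m = l + 1`.

**Analytic part.** The polynomials `P₀ = c`, `Pₙ₊₁ = Pₙ² - c` (`critPoly`) have degree `2ⁿ` and are
bounded by `4` on the Mandelbrot set, so the maximum principle outside it gives
`|Pₙ| ≤ 4 |φ| ^ (2ⁿ)` (`norm_critQuotient_le`). Hence the quotients `Pₙ / φ ^ (2ⁿ)`, which are `1` at
infinity, have Taylor coefficients bounded uniformly in `n`. If `Fₙ` denotes the formal `2ⁿ`-th root
of `x ^ (2ⁿ) Pₙ(1 / x)` (`critRoot`), the quotient is `(Fₙ / G) ^ (2ⁿ)`; as the coefficients of `Fₙ`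
stabilize, a discrepancy `a x ^ m` between their limit and `G` would contribute the unbounded
`2ⁿ a` to the `m`-th coefficient. So `G` is the coefficientwise limit of the `Fₙ`
(`coeff_eq_coeff_critRoot`). No Böttcher coordinate has to be constructed.

**Arithmetic part.** Let `v(m) = m + ord (m!)`. Series with `m`-th coefficient in `2 ^ (-v(m)) ℤ`
form a ring `A` (`dyadicSeries`). Here `F₁ = (1 - x) ^ (1/2)`, whose coefficients are odd multiples
of `2 ^ (-v(m))`, and the ratios `Fₙ₊₁ / Fₙ = (1 - x ^ (2ⁿ⁺¹ - 1) / pₙ²) ^ (1 / 2ⁿ⁺¹)`, with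
`pₙ(x) = x ^ (2ⁿ) Pₙ(1 / x)`, are `1` modulo `2A` for `n ≥ 1`, since the high power of `x` outweighs
the denominators of the binomial coefficients (`dyadicRoot_congr_one`). So
`G ≡ (1 - x) ^ (1/2)` modulo `2A`, which settles `φ`.

For `ψ`, Lagrange inversion (`IsFormalComp.lagrange`) gives `l C_l = -[x ^ (l+1)] G ^ l`, and
`G ^ l ≡ (1 - x) ^ (l/2)` modulo `2A`, where for odd `l` the coefficients again are odd multiples of
`2 ^ (-v(m))`. As `C_l` lies in `2 ^ (-v(l+1)) ℤ` (`IsFormalComp.isDyadicAt`), it is an odd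
multiple of `2 ^ (-v(l+1))` too.
-/

/-! ### Series with controlled powers of two in the denominators -/

/-- The exponent `m + ord (m!)`, where `ord` is the `2`-adic valuation. -/
def dyadicWeight (m : ℕ) : ℕ := m + padicValNat 2 m.factorial

/-- Superadditivity of the weight; it reflects the integrality of binomial coefficients. -/
theorem dyadicWeight_add_le (i j : ℕ) :
    dyadicWeight i + dyadicWeight j ≤ dyadicWeight (i + j) := by
  have h : padicValNat 2 (i.factorial * j.factorial) ≤ padicValNat 2 (i + j).factorial :=
    (padicValNat_dvd_iff_le (Nat.factorial_ne_zero _)).1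
      (pow_padicValNat_dvd.trans (Nat.factorial_mul_factorial_dvd_factorial_add i j))
  rw [padicValNat.mul (Nat.factorial_ne_zero _) (Nat.factorial_ne_zero _)] at h
  unfold dyadicWeight
  omega

theorem dyadicWeight_mono {i j : ℕ} (h : i ≤ j) : dyadicWeight i ≤ dyadicWeight j := by
  obtain ⟨k, rfl⟩ := Nat.exists_eq_add_of_le h
  exact le_self_add.trans (dyadicWeight_add_le i k)

/-- `z` lies in `2⁻ᵉ ℤ`. -/
def IsDyadicAt (e : ℕ) (z : ℂ) : Prop := ∃ a : ℤ, z * 2 ^ e = a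

namespace IsDyadicAt

theorem intCast (e : ℕ) (a : ℤ) : IsDyadicAt e a := ⟨a * 2 ^ e, by push_cast; ring⟩

theorem zero (e : ℕ) : IsDyadicAt e 0 := by simpa using intCast e 0

theorem mono {e f : ℕ} (h : e ≤ f) {z : ℂ} : IsDyadicAt e z → IsDyadicAt f z := by
  rintro ⟨a, ha⟩
  obtain ⟨k, rfl⟩ := Nat.exists_eq_add_of_le h
  exact ⟨a * 2 ^ k, by push_cast; rw [← ha]; ring⟩

theorem add {e : ℕ} {z w : ℂ} : IsDyadicAt e z → IsDyadicAt e w → IsDyadicAt e (z + w) := by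
  rintro ⟨a, ha⟩ ⟨b, hb⟩
  exact ⟨a + b, by push_cast; rw [add_mul, ha, hb]⟩

theorem neg {e : ℕ} {z : ℂ} : IsDyadicAt e z → IsDyadicAt e (-z) := by
  rintro ⟨a, ha⟩
  exact ⟨-a, by push_cast; rw [neg_mul, ha]⟩

theorem sub {e : ℕ} {z w : ℂ} (hz : IsDyadicAt e z) (hw : IsDyadicAt e w) :
    IsDyadicAt e (z - w) := by
  rw [sub_eq_add_neg]; exact hz.add hw.neg

theorem mul {e f : ℕ} {z w : ℂ} :
    IsDyadicAt e z → IsDyadicAt f w → IsDyadicAt (e + f) (z * w) := by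
  rintro ⟨a, ha⟩ ⟨b, hb⟩
  exact ⟨a * b, by push_cast; rw [← ha, ← hb]; ring⟩

theorem sum {ι : Type*} {e : ℕ} {s : Finset ι} {f : ι → ℂ}
    (h : ∀ i ∈ s, IsDyadicAt e (f i)) : IsDyadicAt e (∑ i ∈ s, f i) :=
  Finset.sum_induction f (IsDyadicAt e) (fun _ _ => add) (zero e) h

end IsDyadicAt

/-- The power series whose `m`-th coefficient lies in `2⁻ᵛ ℤ` with `v = m + ord (m!)`. -/
def dyadicSeries : Subring (PowerSeries ℂ) where
  carrier := {f | ∀ m, IsDyadicAt (dyadicWeight m) (PowerSeries.coeff m f)}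
  mul_mem' {f g} hf hg m := by
    rw [PowerSeries.coeff_mul]
    refine IsDyadicAt.sum fun ij hij => ?_
    have := dyadicWeight_add_le ij.1 ij.2
    rw [Finset.HasAntidiagonal.mem_antidiagonal.1 hij] at this
    exact ((hf ij.1).mul (hg ij.2)).mono this
  one_mem' m := by
    rw [PowerSeries.coeff_one]
    split_ifs
    · simpa using IsDyadicAt.intCast _ 1
    · exact IsDyadicAt.zero _
  add_mem' hf hg m := by rw [map_add]; exact (hf m).add (hg m)
  zero_mem' m := by rw [map_zero]; exact IsDyadicAt.zero _
  neg_mem' hf m := by rw [map_neg]; exact (hf m).neg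

theorem inv_mem_dyadicSeries {f : PowerSeries ℂ} (hf : f ∈ dyadicSeries)
    (h1 : PowerSeries.constantCoeff f = 1) : f⁻¹ ∈ dyadicSeries := by
  intro m
  induction m using Nat.strong_induction_on with
  | _ m ih =>
    rw [PowerSeries.coeff_inv]
    split_ifs with hm
    · simpa [h1] using IsDyadicAt.intCast _ 1
    · rw [h1, inv_one, neg_one_mul]
      refine (IsDyadicAt.sum fun ij hij => ?_).neg
      split_ifs with hlt
      · have := dyadicWeight_add_le ij.1 ij.2
        rw [Finset.HasAntidiagonal.mem_antidiagonal.1 hij] at this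
        exact ((hf ij.1).mul (ih ij.2 hlt)).mono this
      · exact IsDyadicAt.zero _

/-- Congruence of power series modulo `2 • dyadicSeries`. -/
def DyadicCongr (f g : PowerSeries ℂ) : Prop := PowerSeries.C (1 / 2 : ℂ) * (f - g) ∈ dyadicSeries

namespace DyadicCongr

theorem refl (f : PowerSeries ℂ) : DyadicCongr f f := by
  simp [DyadicCongr, dyadicSeries.zero_mem]

theorem mem {f g : PowerSeries ℂ} (h : DyadicCongr f g) (hg : g ∈ dyadicSeries) :
    f ∈ dyadicSeries := by
  have h2 : f = PowerSeries.C (1 / 2 : ℂ) * (f - g) + PowerSeries.C (1 / 2 : ℂ) * (f - g) + g := by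
    rw [← add_mul, ← map_add]; norm_num
  rw [h2]
  exact dyadicSeries.add_mem (dyadicSeries.add_mem h h) hg

theorem mul {f g f' g' : PowerSeries ℂ} (h : DyadicCongr f g) (h' : DyadicCongr f' g')
    (hg : g ∈ dyadicSeries) (hg' : g' ∈ dyadicSeries) : DyadicCongr (f * f') (g * g') := by
  have := dyadicSeries.add_mem (dyadicSeries.mul_mem h (h'.mem hg')) (dyadicSeries.mul_mem h' hg)
  unfold DyadicCongr
  convert this using 1
  ring

theorem pow {f g : PowerSeries ℂ} (h : DyadicCongr f g) (hg : g ∈ dyadicSeries) (l : ℕ) :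
    DyadicCongr (f ^ l) (g ^ l) := by
  induction l with
  | zero => simpa using refl 1
  | succ l ih => rw [pow_succ, pow_succ]; exact ih.mul h (dyadicSeries.pow_mem hg l) hg

theorem odd_coeff {f g : PowerSeries ℂ} (h : DyadicCongr f g) (m : ℕ)
    (hg : ∃ a : ℤ, Odd a ∧ PowerSeries.coeff m g * 2 ^ dyadicWeight m = a) :
    ∃ a : ℤ, Odd a ∧ PowerSeries.coeff m f * 2 ^ dyadicWeight m = a := by
  obtain ⟨a, ha, hag⟩ := hg
  obtain ⟨b, hb⟩ := h m
  refine ⟨a + 2 * b, ha.add_even (even_two_mul b), ?_⟩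
  rw [PowerSeries.coeff_C_mul, map_sub] at hb
  push_cast
  rw [← hag, ← hb]
  ring

end DyadicCongr

/-! ### Binomial coefficients with dyadic upper entry -/

theorem prod_sub_eq_factorial_mul_choose {R : Type*} [CommRing R] [BinomialRing R] (r : R)
    (k : ℕ) : (∏ i ∈ Finset.range k, (r - i)) = k.factorial * Ring.choose r k := by
  rw [← nsmul_eq_mul, ← Ring.descPochhammer_eq_factorial_smul_choose]
  induction k with
  | zero => simp
  | succ k ih =>
    rw [Finset.prod_range_succ, ih, descPochhammer_succ_right, Polynomial.smeval_mul,
      Polynomial.smeval_sub, Polynomial.smeval_X, Polynomial.smeval_natCast]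
    simp

/-- The odd part of `k!` divides `∏ (a - i q)` over `i < k` for every power `q` of `2`:
modulo the odd part, `q` is invertible, and the product is `qᵏ` times `k` consecutive integers. -/
theorem odd_dvd_prod_sub_mul {t : ℕ} (ht : Odd t) {k : ℕ} (htk : t ∣ k.factorial) (a : ℤ) (n : ℕ) :
    (t : ℤ) ∣ ∏ i ∈ Finset.range k, (a - i * 2 ^ n) := by
  have hcop : IsCoprime ((2 : ℤ) ^ n) (t : ℤ) :=
    IsCoprime.pow_left (by exact_mod_cast ht.coprime_two_left.isCoprime)
  obtain ⟨u, w, huw⟩ := hcop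
  -- `b` is `a / 2 ^ n` modulo `t`
  set b : ℤ := a * u
  have h1 : (∏ i ∈ Finset.range k, (a - i * 2 ^ n)) ≡
      ∏ i ∈ Finset.range k, (2 ^ n * (b - i)) [ZMOD t] := by
    refine Int.ModEq.prod fun i _ => ?_
    refine Int.modEq_iff_dvd.2 ⟨-(a * w), ?_⟩
    simp only [b]
    linear_combination a * huw
  have h2 : (t : ℤ) ∣ ∏ i ∈ Finset.range k, (2 ^ n * (b - i)) := by
    rw [Finset.prod_mul_distrib]
    refine Dvd.dvd.mul_left ?_ _
    have h3 : (∏ i ∈ Finset.range k, (b - i)) = k.factorial * Ring.choose b k := by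
      exact prod_sub_eq_factorial_mul_choose b k
    rw [h3]
    exact Dvd.dvd.mul_right (Int.natCast_dvd_natCast.2 htk) _
  exact (Int.ModEq.dvd_iff h1).2 h2

/-- `2 ^ (n k + ord (k!))` clears the denominator of the binomial coefficient of `a / 2ⁿ` over
`k`; for odd `a` and `n ≥ 1` the resulting integer is odd. -/
theorem exists_choose_div_two_pow (a : ℤ) (n k : ℕ) :
    ∃ R : ℤ, Ring.choose ((a : ℂ) / 2 ^ n) k * 2 ^ (n * k + padicValNat 2 k.factorial) = R ∧
      (Odd a → n ≠ 0 → Odd R) := by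
  obtain ⟨t, ht⟩ : 2 ^ padicValNat 2 k.factorial ∣ k.factorial := pow_padicValNat_dvd
  have hodd : Odd t := by
    rw [← Nat.not_even_iff_odd, even_iff_two_dvd]
    rintro ⟨s, rfl⟩
    refine pow_succ_padicValNat_not_dvd (p := 2) (Nat.factorial_ne_zero k) ⟨s, ?_⟩
    rw [pow_succ, mul_assoc]
    exact ht
  obtain ⟨R, hR⟩ := odd_dvd_prod_sub_mul hodd ⟨_, ht.trans (mul_comm _ _)⟩ a n
  refine ⟨R, ?_, fun ha hn => ?_⟩
  · have ht0 : (t : ℂ) ≠ 0 := Nat.cast_ne_zero.2 hodd.pos.ne'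
    have h3 : (∏ i ∈ Finset.range k, ((a : ℂ) / 2 ^ n - i)) =
        k.factorial * Ring.choose ((a : ℂ) / 2 ^ n) k :=
      prod_sub_eq_factorial_mul_choose _ k
    have h4 : ((∏ i ∈ Finset.range k, (a - i * 2 ^ n) : ℤ) : ℂ) =
        (∏ i ∈ Finset.range k, ((a : ℂ) / 2 ^ n - i)) * 2 ^ (n * k) := by
      push_cast
      rw [pow_mul, ← Finset.card_range k, ← Finset.prod_const, Finset.card_range,
        ← Finset.prod_mul_distrib]
      refine Finset.prod_congr rfl fun i _ => ?_
      field_simp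
    rw [hR, h3, ht] at h4
    push_cast at h4
    apply mul_left_cancel₀ ht0
    rw [h4, pow_add]
    ring
  · have h5 : Odd (∏ i ∈ Finset.range k, (a - i * 2 ^ n)) := by
      refine Finset.prod_induction _ Odd (fun _ _ => Odd.mul) odd_one fun i _ => ?_
      exact ha.sub_even ((even_two.pow_of_ne_zero hn).mul_left _)
    rw [hR] at h5
    exact (Int.odd_mul.1 h5).2

/-! ### Formal roots of order a power of two -/

/-- The formal power series `(1 - b) ^ (1 / 2ⁿ)`, for `b` without constant term. -/
noncomputable def dyadicRoot (n : ℕ) (b : PowerSeries ℂ) : PowerSeries ℂ :=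
  (PowerSeries.binomialSeries ℂ (1 / 2 ^ n : ℂ)).subst (-b)

theorem binomialSeries_pow (r : ℂ) (l : ℕ) :
    PowerSeries.binomialSeries ℂ r ^ l = PowerSeries.binomialSeries ℂ (l * r) := by
  induction l with
  | zero => simp
  | succ l ih => rw [pow_succ, ih, ← PowerSeries.binomialSeries_add]; congr 1; push_cast; ring

theorem hasSubst_neg {b : PowerSeries ℂ} (hb : PowerSeries.constantCoeff b = 0) :
    PowerSeries.HasSubst (-b) :=
  PowerSeries.HasSubst.of_constantCoeff_zero' (by rw [map_neg, hb, neg_zero])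

theorem dyadicRoot_pow (n : ℕ) {b : PowerSeries ℂ} (hb : PowerSeries.constantCoeff b = 0) :
    dyadicRoot n b ^ 2 ^ n = 1 - b := by
  have h := hasSubst_neg hb
  have h1 : ((2 ^ n : ℕ) : ℂ) * (1 / 2 ^ n) = (1 : ℕ) := by push_cast; field_simp
  rw [dyadicRoot, ← PowerSeries.subst_pow h, binomialSeries_pow, h1,
    PowerSeries.binomialSeries_nat, pow_one, PowerSeries.subst_add h, PowerSeries.subst_X h,
    ← PowerSeries.coe_substAlgHom h, map_one, sub_eq_add_neg]

theorem coeff_dyadicRoot (n : ℕ) {b : PowerSeries ℂ} (hb : PowerSeries.constantCoeff b = 0)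
    (m : ℕ) : PowerSeries.coeff m (dyadicRoot n b) = ∑ᶠ k : ℕ,
      Ring.choose (1 / 2 ^ n : ℂ) k * PowerSeries.coeff m ((-b) ^ k) := by
  rw [dyadicRoot, PowerSeries.coeff_subst' (hasSubst_neg hb)]
  simp

theorem coeff_mul_X_pow_pow_eq_zero {M k m : ℕ} (h : m < M * k) (e : PowerSeries ℂ) :
    PowerSeries.coeff m ((-(e * PowerSeries.X ^ M)) ^ k) = 0 := by
  rw [neg_mul_eq_neg_mul, mul_pow, ← pow_mul, PowerSeries.coeff_mul_X_pow',
    if_neg (by omega)]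

theorem constantCoeff_mul_X_pow {M : ℕ} (hM : M ≠ 0) (e : PowerSeries ℂ) :
    PowerSeries.constantCoeff (e * PowerSeries.X ^ M) = 0 := by
  rw [map_mul, map_pow, PowerSeries.constantCoeff_X, zero_pow hM, mul_zero]

theorem coeff_dyadicRoot_of_lt (n : ℕ) {M m : ℕ} (h : m < M) (e : PowerSeries ℂ) :
    PowerSeries.coeff m (dyadicRoot n (e * PowerSeries.X ^ M)) =
      PowerSeries.coeff m (1 : PowerSeries ℂ) := by
  rw [coeff_dyadicRoot n (constantCoeff_mul_X_pow (by omega) e), finsum_eq_single _ 0]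
  · simp
  · intro k hk
    rw [coeff_mul_X_pow_pow_eq_zero (h.trans_le (Nat.le_mul_of_pos_right M (by omega))), mul_zero]

/-- For integral `e` and `M > n`, the denominators of `(1 - e X ^ M) ^ (1 / 2ⁿ)` are too small
to matter modulo `2 • dyadicSeries`. -/
theorem dyadicRoot_congr_one {n M : ℕ} (h : n < M) (e : PowerSeries ℤ) :
    DyadicCongr (dyadicRoot n (PowerSeries.map (Int.castRingHom ℂ) e * PowerSeries.X ^ M)) 1 := by
  intro m
  rw [PowerSeries.coeff_C_mul, map_sub]
  rcases lt_or_ge m M with hm | hm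
  · rw [coeff_dyadicRoot_of_lt n hm, sub_self, mul_zero]
    exact IsDyadicAt.zero _
  rw [PowerSeries.coeff_one, if_neg (by omega), sub_zero,
    coeff_dyadicRoot n (constantCoeff_mul_X_pow (by omega) _), ← smul_eq_mul, smul_finsum]
  refine finsum_induction _ (IsDyadicAt.zero _) (fun _ _ => IsDyadicAt.add) fun k => ?_
  rw [smul_eq_mul]
  rcases Nat.eq_zero_or_pos k with rfl | hk
  · simpa [PowerSeries.coeff_one, show m ≠ 0 by omega] using IsDyadicAt.zero _
  rcases lt_or_ge m (M * k) with hmk | hmk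
  · rw [coeff_mul_X_pow_pow_eq_zero hmk]
    simpa using IsDyadicAt.zero _
  obtain ⟨R, hR, -⟩ := exists_choose_div_two_pow 1 n k
  have h1 : IsDyadicAt (1 + (n * k + padicValNat 2 k.factorial))
      (1 / 2 * Ring.choose (1 / 2 ^ n : ℂ) k) :=
    IsDyadicAt.mul ⟨1, by norm_num⟩ ⟨R, by simpa using hR⟩
  have h2 : ((-(PowerSeries.map (Int.castRingHom ℂ) e * PowerSeries.X ^ M)) ^ k) =
      PowerSeries.map (Int.castRingHom ℂ) ((-(e * PowerSeries.X ^ M)) ^ k) := by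
    simp
  rw [h2, PowerSeries.coeff_map, ← mul_assoc]
  have h3 := h1.mul (IsDyadicAt.intCast 0 (PowerSeries.coeff m ((-(e * PowerSeries.X ^ M)) ^ k)))
  refine h3.mono (le_trans ?_ (dyadicWeight_mono hmk))
  have h4 : k ≤ M * k := Nat.le_mul_of_pos_left k (by omega)
  have h5 : padicValNat 2 k.factorial ≤ padicValNat 2 (M * k).factorial :=
    (padicValNat_dvd_iff_le (Nat.factorial_ne_zero _)).1
      (pow_padicValNat_dvd.trans (Nat.factorial_dvd_factorial h4))
  have h6 : (n + 1) * k ≤ M * k := Nat.mul_le_mul_right k h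
  unfold dyadicWeight
  nlinarith

/-- The coefficient of `X ^ m` in `(1 - X) ^ (l / 2)` for odd `l` is an odd multiple of
`2 ^ (-(m + ord (m!)))`. -/
theorem odd_coeff_dyadicRoot_one_X_pow {l : ℕ} (hl : Odd l) (m : ℕ) :
    ∃ a : ℤ, Odd a ∧
      PowerSeries.coeff m (dyadicRoot 1 PowerSeries.X ^ l) * 2 ^ dyadicWeight m = a := by
  have h : PowerSeries.HasSubst (-PowerSeries.X : PowerSeries ℂ) := hasSubst_neg (by simp)
  obtain ⟨R, hR, hodd⟩ := exists_choose_div_two_pow l 1 m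
  refine ⟨(-1) ^ m * R, (odd_neg_one.pow).mul (hodd (by exact_mod_cast hl) one_ne_zero), ?_⟩
  have h2 : ((l : ℤ) : ℂ) / 2 ^ 1 = l * (1 / 2 ^ 1) := by push_cast; ring
  rw [one_mul, h2] at hR
  rw [dyadicRoot, ← PowerSeries.subst_pow h, binomialSeries_pow, PowerSeries.coeff_subst' h,
    finsum_eq_single _ m]
  · rw [neg_pow, ← map_one (PowerSeries.C (R := ℂ)), ← map_neg, ← map_pow, PowerSeries.coeff_C_mul,
      PowerSeries.coeff_X_pow_self]
    push_cast
    rw [← hR, PowerSeries.binomialSeries_coeff, dyadicWeight]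
    simp only [smul_eq_mul]
    ring
  · intro k hk
    rw [neg_pow, ← map_one (PowerSeries.C (R := ℂ)), ← map_neg, ← map_pow, PowerSeries.coeff_C_mul,
      PowerSeries.coeff_X_pow, if_neg (Ne.symm hk)]
    simp

/-! ### Roots of the critical polynomials -/

/-- The polynomials `x ^ (2ⁿ) f_c^(n+1)(0)` in `x = 1 / c` (up to the sign for `n = 0`), as integral
power series. -/
noncomputable def critSeries : ℕ → PowerSeries ℤ
  | 0 => 1
  | n + 1 => critSeries n ^ 2 - PowerSeries.X ^ (2 ^ (n + 1) - 1)

theorem two_pow_succ_sub_one_ne_zero (n : ℕ) : 2 ^ (n + 1) - 1 ≠ 0 := by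
  have := Nat.one_lt_two_pow (n := n + 1) (by omega)
  omega

theorem constantCoeff_critSeries (n : ℕ) : PowerSeries.constantCoeff (critSeries n) = 1 := by
  induction n with
  | zero => simp [critSeries]
  | succ n ih => simp [critSeries, ih, two_pow_succ_sub_one_ne_zero n]

theorem critSeries_mul_invOfUnit (n : ℕ) :
    critSeries n * PowerSeries.invOfUnit (critSeries n) 1 = 1 :=
  PowerSeries.mul_invOfUnit _ _ (by rw [constantCoeff_critSeries, Units.val_one])

/-- The `2ⁿ`-th root of `critSeries n` with constant term `1`, built from
`critSeries (n + 1) = (critSeries n) ^ 2 * (1 - X ^ (2 ^ (n + 1) - 1) / (critSeries n) ^ 2)`. -/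
noncomputable def critRoot : ℕ → PowerSeries ℂ
  | 0 => 1
  | n + 1 => critRoot n * dyadicRoot (n + 1) (PowerSeries.map (Int.castRingHom ℂ)
      (PowerSeries.invOfUnit (critSeries n) 1 ^ 2) * PowerSeries.X ^ (2 ^ (n + 1) - 1))

theorem critRoot_pow (n : ℕ) :
    critRoot n ^ 2 ^ n = PowerSeries.map (Int.castRingHom ℂ) (critSeries n) := by
  induction n with
  | zero => simp [critRoot, critSeries]
  | succ n ih =>
    rw [critRoot, mul_pow,
      dyadicRoot_pow _ (constantCoeff_mul_X_pow (two_pow_succ_sub_one_ne_zero n) _),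
      critSeries]
    generalize 2 ^ (n + 1) - 1 = M
    rw [pow_succ 2 n, pow_mul, ih]
    have h := congrArg (fun f => PowerSeries.map (Int.castRingHom ℂ) (f ^ 2))
      (critSeries_mul_invOfUnit n)
    simp only [mul_pow, one_pow, map_mul, map_pow, map_one, map_sub, PowerSeries.map_X] at h ⊢
    linear_combination (-PowerSeries.X ^ M) * h

theorem coeff_critRoot_succ {n m : ℕ} (h : m ≤ n) :
    PowerSeries.coeff m (critRoot (n + 1)) = PowerSeries.coeff m (critRoot n) := by
  have hlt : n < 2 ^ (n + 1) - 1 := by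
    have := Nat.lt_two_pow_self (n := n)
    rw [pow_succ]; omega
  rw [critRoot, PowerSeries.coeff_mul, ← mul_one (critRoot n), PowerSeries.coeff_mul]
  refine Finset.sum_congr rfl fun ij hij => ?_
  rw [coeff_dyadicRoot_of_lt, mul_one]
  have := Finset.HasAntidiagonal.mem_antidiagonal.1 hij
  omega

theorem coeff_critRoot_eq {n m : ℕ} (h : m ≤ n) :
    PowerSeries.coeff m (critRoot n) = PowerSeries.coeff m (critRoot m) := by
  induction n, h using Nat.le_induction with
  | base => rfl
  | succ n hn ih => rw [coeff_critRoot_succ hn, ih]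

theorem dyadicRoot_one_X_mem : dyadicRoot 1 PowerSeries.X ∈ dyadicSeries := fun m => by
  obtain ⟨a, -, ha⟩ := odd_coeff_dyadicRoot_one_X_pow odd_one m
  exact ⟨a, by rwa [pow_one] at ha⟩

theorem critRoot_succ_congr (n : ℕ) :
    DyadicCongr (critRoot (n + 1)) (dyadicRoot 1 PowerSeries.X) := by
  induction n with
  | zero =>
    have h : PowerSeries.invOfUnit (1 : PowerSeries ℤ) 1 = 1 := by
      simpa [critSeries] using critSeries_mul_invOfUnit 0
    simpa [critRoot, critSeries, h] using DyadicCongr.refl _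
  | succ n ih =>
    have hlt : n + 1 + 1 < 2 ^ (n + 1 + 1) - 1 := by
      have := Nat.lt_two_pow_self (n := n)
      rw [pow_succ, pow_succ]; omega
    have := ih.mul (dyadicRoot_congr_one hlt (PowerSeries.invOfUnit (critSeries (n + 1)) 1 ^ 2))
      dyadicRoot_one_X_mem dyadicSeries.one_mem
    rw [mul_one] at this
    rw [critRoot]
    exact this

/-- Perturbing the base of a `k`-th power at order `m` changes the power, relative to it, by `k`
times the perturbation at order `m`. -/
theorem coeff_of_mul_pow_eq_pow {F G H : PowerSeries ℂ} {k m : ℕ} (hm : m ≠ 0)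
    (hG : PowerSeries.constantCoeff G = 1)
    (hFG : ∀ i < m, PowerSeries.coeff i F = PowerSeries.coeff i G) (hH : H * G ^ k = F ^ k) :
    PowerSeries.coeff m H = k * (PowerSeries.coeff m F - PowerSeries.coeff m G) := by
  obtain ⟨u, hu⟩ : PowerSeries.X ^ m ∣ F - G :=
    PowerSeries.X_pow_dvd_iff.2 fun i hi => by rw [map_sub, hFG i hi, sub_self]
  have hF : F = G + PowerSeries.X ^ m * u := by rw [← hu]; ring
  obtain ⟨t, ht⟩ := Polynomial.powAddExpansion G (PowerSeries.X ^ m * u) k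
  rw [← hF, ← hH] at ht
  have hGinv : G * G⁻¹ = 1 := PowerSeries.mul_inv_cancel _ (by simp [hG])
  have hGinvk : G ^ k * G⁻¹ ^ k = 1 := by rw [← mul_pow, hGinv, one_pow]
  have hw : H = 1 + PowerSeries.X ^ m *
      (((k : PowerSeries ℂ) * G ^ (k - 1) * u + PowerSeries.X ^ m * (t * u ^ 2)) * G⁻¹ ^ k) := by
    linear_combination G⁻¹ ^ k * ht + (1 - H) * hGinvk
  have hc : PowerSeries.coeff m F - PowerSeries.coeff m G = PowerSeries.constantCoeff u := by
    have := congrArg (PowerSeries.coeff (0 + m)) hu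
    rw [PowerSeries.coeff_X_pow_mul, zero_add, map_sub] at this
    simpa using this
  rw [hc, hw]
  have := PowerSeries.coeff_X_pow_mul
    (((k : PowerSeries ℂ) * G ^ (k - 1) * u + PowerSeries.X ^ m * (t * u ^ 2)) * G⁻¹ ^ k) m 0
  rw [zero_add] at this
  rw [map_add, this]
  simp [PowerSeries.coeff_one, hm, hG]

/-- If the relative errors `h n` of `G ^ (2ⁿ)` as approximations to `critSeries n` have
coefficients bounded uniformly in `n`, then `G` is the coefficientwise limit of the roots of the
`critSeries n`: a discrepancy at order `m` would be multiplied by `2ⁿ`. -/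
theorem coeff_eq_coeff_critRoot {G : PowerSeries ℂ} (hG : PowerSeries.constantCoeff G = 1)
    {h : ℕ → PowerSeries ℂ} {K : ℕ → ℝ}
    (hh : ∀ n, h n * G ^ 2 ^ n = PowerSeries.map (Int.castRingHom ℂ) (critSeries n))
    (hK : ∀ n m, ‖PowerSeries.coeff m (h n)‖ ≤ K m) (m : ℕ) :
    PowerSeries.coeff m G = PowerSeries.coeff m (critRoot m) := by
  induction m using Nat.strong_induction_on with
  | _ m ih =>
    rcases Nat.eq_zero_or_pos m with rfl | hm
    · simp [hG, critRoot]
    by_contra hne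
    have hpos : 0 < ‖PowerSeries.coeff m (critRoot m) - PowerSeries.coeff m G‖ :=
      norm_pos_iff.2 (sub_ne_zero.2 (Ne.symm hne))
    obtain ⟨n, hn⟩ := pow_unbounded_of_one_lt
      (K m / ‖PowerSeries.coeff m (critRoot m) - PowerSeries.coeff m G‖) one_lt_two
    have hb : ∀ j ≥ m, (2 : ℝ) ^ j *
        ‖PowerSeries.coeff m (critRoot m) - PowerSeries.coeff m G‖ ≤ K m := by
      intro j hj
      have h1 := coeff_of_mul_pow_eq_pow (F := critRoot j) (H := h j) (k := 2 ^ j) hm.ne' hG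
        (fun i hi => by rw [ih i hi, coeff_critRoot_eq (by omega)])
        (by rw [hh, critRoot_pow])
      rw [coeff_critRoot_eq hj] at h1
      have h2 := hK j m
      rw [h1, norm_mul] at h2
      simpa using h2
    have h3 := hb (max n m) (le_max_right _ _)
    have h4 : (2 : ℝ) ^ n ≤ 2 ^ max n m := pow_le_pow_right₀ one_le_two (le_max_left _ _)
    rw [div_lt_iff₀ hpos] at hn
    nlinarith

/-- A series whose coefficients are the limits of those of `critRoot` agrees with `(1 - X) ^ (1/2)`
modulo `2 • dyadicSeries`. -/
theorem congr_of_coeff_eq_critRoot {G : PowerSeries ℂ}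
    (h : ∀ m, PowerSeries.coeff m G = PowerSeries.coeff m (critRoot m)) :
    DyadicCongr G (dyadicRoot 1 PowerSeries.X) := fun m => by
  have := critRoot_succ_congr m m
  rwa [PowerSeries.coeff_C_mul, map_sub, coeff_critRoot_succ le_rfl, ← h m, ← map_sub,
    ← PowerSeries.coeff_C_mul] at this

/-! ### Lagrange inversion -/

/-- `∑ dₘ yᵐ` agrees with `g` to every order: the partial sums have errors divisible by powers
of `y`. This says that `g` is the composition of `∑ dₘ Xᵐ` with `y`. -/
def IsFormalComp (d : ℕ → ℂ) (y g : PowerSeries ℂ) : Prop :=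
  ∀ n, ∃ R : PowerSeries ℂ, g = ∑ m ∈ Finset.range n, PowerSeries.C (d m) * y ^ m + y ^ n * R

section Inversion

variable {d : ℕ → ℂ} {G : PowerSeries ℂ}

/-- The coefficients of the inverse series inherit the bound on denominators. -/
theorem IsFormalComp.isDyadicAt (hG : G ∈ dyadicSeries) (hG1 : PowerSeries.constantCoeff G = 1)
    (hd : IsFormalComp d (PowerSeries.X * G⁻¹) G⁻¹) (n : ℕ) :
    IsDyadicAt (dyadicWeight n) (d n) := by
  have hK := inv_mem_dyadicSeries hG hG1
  induction n using Nat.strong_induction_on with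
  | _ n ih =>
    obtain ⟨R, hR⟩ := hd (n + 1)
    have hcoeff : ∀ m ≤ n, PowerSeries.coeff n (PowerSeries.C (d m) * (PowerSeries.X * G⁻¹) ^ m) =
        d m * PowerSeries.coeff (n - m) (G⁻¹ ^ m) := fun m hm => by
      rw [PowerSeries.coeff_C_mul, mul_pow, PowerSeries.coeff_X_pow_mul', if_pos hm]
    have h1 := congrArg (PowerSeries.coeff n) hR
    rw [map_add, mul_pow, mul_assoc, PowerSeries.coeff_X_pow_mul', if_neg (by omega), add_zero,
      map_sum, Finset.sum_range_succ, hcoeff n le_rfl, Nat.sub_self] at h1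
    have h2 : d n = PowerSeries.coeff n G⁻¹ - ∑ m ∈ Finset.range n,
        PowerSeries.coeff n (PowerSeries.C (d m) * (PowerSeries.X * G⁻¹) ^ m) := by
      rw [h1]; simp [hG1]
    rw [h2]
    refine (hK n).sub (IsDyadicAt.sum fun m hm => ?_)
    have hm := Finset.mem_range.1 hm
    rw [hcoeff m hm.le]
    have hw := dyadicWeight_add_le m (n - m)
    rw [Nat.add_sub_of_le hm.le] at hw
    exact ((ih m hm).mul (dyadicSeries.pow_mem hK m (n - m))).mono hw

theorem coeff_pow_sub_X_mul_derivative (G : PowerSeries ℂ) {k n : ℕ} :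
    (k + 1 : ℂ) * PowerSeries.coeff n
      (G ^ (k + 1) - PowerSeries.X * (G ^ k * PowerSeries.derivative ℂ G)) =
      (k + 1 - n) * PowerSeries.coeff n (G ^ (k + 1)) := by
  have h1 : PowerSeries.derivative ℂ (G ^ (k + 1)) =
      PowerSeries.C (k + 1 : ℂ) * (G ^ k * PowerSeries.derivative ℂ G) := by
    rw [PowerSeries.derivative_pow]; simp; ring
  have h2 : PowerSeries.coeff n (PowerSeries.X * PowerSeries.derivative ℂ (G ^ (k + 1))) =
      n * PowerSeries.coeff n (G ^ (k + 1)) := by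
    cases n with
    | zero => simp
    | succ n => rw [PowerSeries.coeff_succ_X_mul, PowerSeries.coeff_derivative]; push_cast; ring
  rw [h1, mul_left_comm, PowerSeries.coeff_C_mul] at h2
  rw [map_sub, mul_sub, h2]
  ring

/-- **Lagrange inversion** for `y = X / G`: if `∑ dₘ yᵐ = 1 / G`, then
`l d_(l+1) = -[X ^ (l+1)] G ^ l`. The linear functional
`f ↦ [Xⁿ] f (Gⁿ - X G ^ (n-1) G')` is the residue of `f d y / y ^ (n+1)`, so it takes the value
`1` at `yⁿ` and `0` at the other powers of `y`. -/
theorem IsFormalComp.lagrange (hG1 : PowerSeries.constantCoeff G = 1)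
    (hd : IsFormalComp d (PowerSeries.X * G⁻¹) G⁻¹) {l : ℕ} (hl : l ≠ 0) :
    l * d (l + 1) = -PowerSeries.coeff (l + 1) (G ^ l) := by
  obtain ⟨k, rfl⟩ := Nat.exists_eq_succ_of_ne_zero hl
  obtain ⟨R, hR⟩ := hd (k + 1 + 1 + 1)
  have hGi : G * G⁻¹ = 1 := PowerSeries.mul_inv_cancel _ (by simp [hG1])
  set W : PowerSeries ℂ :=
    G ^ (k + 1 + 1) - PowerSeries.X * (G ^ (k + 1) * PowerSeries.derivative ℂ G) with hW
  -- the functional vanishes at lower powers of `y`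
  have hlow : ∀ m ∈ Finset.range (k + 1 + 1), PowerSeries.coeff (k + 1 + 1)
      (PowerSeries.C (d m) * (PowerSeries.X * G⁻¹) ^ m * W) = 0 := by
    intro m hm
    have hm := Finset.mem_range.1 hm
    obtain ⟨j, hj⟩ := Nat.exists_eq_add_of_le (Nat.lt_succ_iff.1 hm)
    have hGm : G ^ m * G⁻¹ ^ m = 1 := by rw [← mul_pow, hGi, one_pow]
    have h1 : PowerSeries.C (d m) * (PowerSeries.X * G⁻¹) ^ m * W = PowerSeries.C (d m) *
        (PowerSeries.X ^ m *
          (G ^ (j + 1) - PowerSeries.X * (G ^ j * PowerSeries.derivative ℂ G))) := by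
      rw [hW, hj, mul_pow, show m + j + 1 = m + (j + 1) by ring, pow_add, pow_add]
      linear_combination PowerSeries.C (d m) * PowerSeries.X ^ m *
        (G ^ (j + 1) - PowerSeries.X * (G ^ j * PowerSeries.derivative ℂ G)) * hGm
    have h2 := coeff_pow_sub_X_mul_derivative G (k := j) (n := j + 1)
    have h3 : (j + 1 : ℂ) ≠ 0 := by exact_mod_cast Nat.succ_ne_zero j
    push_cast at h2
    rw [sub_self, zero_mul] at h2
    rw [h1, PowerSeries.coeff_C_mul, PowerSeries.coeff_X_pow_mul', if_pos (by omega),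
      show k + 1 + 1 - m = j + 1 by omega, (mul_eq_zero.1 h2).resolve_left h3, mul_zero]
  have hself : PowerSeries.coeff (k + 1 + 1)
      (PowerSeries.C (d (k + 1 + 1)) * (PowerSeries.X * G⁻¹) ^ (k + 1 + 1) * W) =
      d (k + 1 + 1) := by
    rw [mul_assoc, PowerSeries.coeff_C_mul, mul_pow, mul_assoc, PowerSeries.coeff_X_pow_mul',
      if_pos le_rfl, Nat.sub_self]
    simp [hW, hG1]
  have hhigh : PowerSeries.coeff (k + 1 + 1)
      ((PowerSeries.X * G⁻¹) ^ (k + 1 + 1 + 1) * R * W) = 0 := by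
    rw [mul_pow, mul_assoc, mul_assoc, PowerSeries.coeff_X_pow_mul', if_neg (by omega)]
  have hmain := congrArg (fun f => PowerSeries.coeff (k + 1 + 1) (f * W)) hR
  simp only [add_mul, map_add, Finset.sum_mul, map_sum] at hmain
  rw [hhigh, Finset.sum_range_succ, Finset.sum_eq_zero hlow, hself, zero_add, add_zero] at hmain
  have hGW : G⁻¹ * W =
      G ^ (k + 1) - PowerSeries.X * (G ^ k * PowerSeries.derivative ℂ G) := by
    rw [hW, pow_succ G (k + 1), pow_succ G k]
    linear_combination (G ^ k * G - PowerSeries.X * (G ^ k * PowerSeries.derivative ℂ G)) * hGi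
  have h4 := coeff_pow_sub_X_mul_derivative G (k := k) (n := k + 1 + 1)
  rw [← hGW, hmain] at h4
  push_cast at h4 ⊢
  rw [h4]
  ring

end Inversion

/-- The formal core: exact powers of `2` in the denominators of a limit `G` of the roots of the
`critSeries n`, and of the inverse series. -/
theorem odd_coeff_of_coeff_eq_critRoot {d : ℕ → ℂ} {G : PowerSeries ℂ}
    (h : ∀ m, PowerSeries.coeff m G = PowerSeries.coeff m (critRoot m))
    (hd : IsFormalComp d (PowerSeries.X * G⁻¹) G⁻¹) {l : ℕ} (hl : Odd l) :
    (∃ a : ℤ, Odd a ∧ PowerSeries.coeff (l + 1) G * 2 ^ dyadicWeight (l + 1) = a) ∧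
      ∃ a : ℤ, Odd a ∧ d (l + 1) * 2 ^ dyadicWeight (l + 1) = a := by
  have hG1 : PowerSeries.constantCoeff G = 1 := by
    simpa [critRoot] using h 0
  have hc := congr_of_coeff_eq_critRoot h
  refine ⟨hc.odd_coeff _ (by simpa using odd_coeff_dyadicRoot_one_X_pow odd_one (l + 1)), ?_⟩
  obtain ⟨a, ha, hal⟩ := (hc.pow dyadicRoot_one_X_mem l).odd_coeff (l + 1)
    (odd_coeff_dyadicRoot_one_X_pow hl (l + 1))
  obtain ⟨b, hb⟩ := hd.isDyadicAt (hc.mem dyadicRoot_one_X_mem) hG1 (l + 1)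
  refine ⟨b, ?_, hb⟩
  have h1 : ((l * b : ℤ) : ℂ) = ((-a : ℤ) : ℂ) := by
    push_cast
    rw [← hb, ← hal, ← mul_assoc, hd.lagrange hG1 hl.pos.ne']
    ring
  have h2 : Odd ((l : ℤ) * b) := by
    rw [Int.cast_injective h1]; exact ha.neg
  exact (Int.odd_mul.1 h2).2

/-! ### Taylor series and expansions at infinity -/

/-- The Taylor series at `0`, as a formal power series. -/
noncomputable def taylorSeries (f : ℂ → ℂ) : PowerSeries ℂ :=
  PowerSeries.mk fun n => (n.factorial : ℂ)⁻¹ * iteratedDeriv n f 0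

theorem coeff_taylorSeries (f : ℂ → ℂ) (n : ℕ) :
    PowerSeries.coeff n (taylorSeries f) = (n.factorial : ℂ)⁻¹ * iteratedDeriv n f 0 :=
  PowerSeries.coeff_mk _ _

theorem constantCoeff_taylorSeries (f : ℂ → ℂ) :
    PowerSeries.constantCoeff (taylorSeries f) = f 0 := by
  rw [← PowerSeries.coeff_zero_eq_constantCoeff_apply, coeff_taylorSeries]
  simp

theorem taylorSeries_congr {f g : ℂ → ℂ} (h : f =ᶠ[𝓝 0] g) : taylorSeries f = taylorSeries g := by
  ext n
  rw [coeff_taylorSeries, coeff_taylorSeries, h.iteratedDeriv_eq]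

theorem taylorSeries_mul {f g : ℂ → ℂ} (hf : AnalyticAt ℂ f 0) (hg : AnalyticAt ℂ g 0) :
    taylorSeries (fun x => f x * g x) = taylorSeries f * taylorSeries g := by
  ext n
  rw [PowerSeries.coeff_mul, Finset.Nat.sum_antidiagonal_eq_sum_range_succ_mk, coeff_taylorSeries,
    iteratedDeriv_fun_mul hf.contDiffAt hg.contDiffAt, Finset.mul_sum]
  refine Finset.sum_congr rfl fun i hi => ?_
  have hi : i ≤ n := Nat.lt_succ_iff.1 (Finset.mem_range.1 hi)
  rw [coeff_taylorSeries, coeff_taylorSeries, Nat.cast_choose ℂ hi]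
  have := Nat.cast_ne_zero (R := ℂ).2 (Nat.factorial_ne_zero n)
  field_simp

theorem taylorSeries_add {f g : ℂ → ℂ} (hf : AnalyticAt ℂ f 0) (hg : AnalyticAt ℂ g 0) :
    taylorSeries (fun x => f x + g x) = taylorSeries f + taylorSeries g := by
  ext n
  rw [map_add, coeff_taylorSeries, coeff_taylorSeries, coeff_taylorSeries,
    iteratedDeriv_fun_add hf.contDiffAt hg.contDiffAt, mul_add]

theorem taylorSeries_const (a : ℂ) : taylorSeries (fun _ => a) = PowerSeries.C a := by
  ext n
  rw [coeff_taylorSeries, iteratedDeriv_const, PowerSeries.coeff_C]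
  split_ifs with h <;> simp [h]

theorem taylorSeries_id : taylorSeries (fun x => x) = PowerSeries.X := by
  ext n
  rw [coeff_taylorSeries, iteratedDeriv_fun_id_zero, PowerSeries.coeff_X]
  split_ifs with h <;> simp [h]

theorem taylorSeries_pow {f : ℂ → ℂ} (hf : AnalyticAt ℂ f 0) (k : ℕ) :
    taylorSeries (fun x => f x ^ k) = taylorSeries f ^ k := by
  induction k with
  | zero => simpa using taylorSeries_const 1
  | succ k ih => simp only [pow_succ]; rw [taylorSeries_mul (hf.fun_pow k) hf, ih]

/-- Taylor series of a composition, in the form of finite expansions. -/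
theorem isFormalComp_taylorSeries {f y : ℂ → ℂ} (hf : AnalyticAt ℂ f 0) (hy : AnalyticAt ℂ y 0)
    (hy0 : y 0 = 0) : IsFormalComp (fun m => PowerSeries.coeff m (taylorSeries f))
      (taylorSeries y) (taylorSeries fun x => f (y x)) := by
  intro n
  induction n generalizing f with
  | zero => exact ⟨taylorSeries fun x => f (y x), by simp⟩
  | succ n ih =>
    have hg : AnalyticAt ℂ (dslope f 0) 0 := by
      obtain ⟨p, hp⟩ := hf
      exact ⟨_, hp.has_fpower_series_dslope_fslope⟩
    have hfg : ∀ u, f u = f 0 + u * dslope f 0 u := fun u => by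
      have := sub_smul_dslope f 0 u
      rw [sub_zero, smul_eq_mul] at this
      rw [this]; ring
    have hgy : AnalyticAt ℂ (fun x => dslope f 0 (y x)) 0 :=
      AnalyticAt.fun_comp (by rwa [hy0]) hy
    have hid : AnalyticAt ℂ (fun x : ℂ => x) 0 := analyticAt_id
    have h1 : taylorSeries f =
        PowerSeries.C (f 0) + PowerSeries.X * taylorSeries (dslope f 0) := by
      rw [← taylorSeries_id, ← taylorSeries_const, ← taylorSeries_mul hid hg,
        ← taylorSeries_add analyticAt_const (hid.fun_mul hg)]
      exact congrArg _ (funext hfg)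
    have h2 : taylorSeries (fun x => f (y x)) =
        PowerSeries.C (f 0) + taylorSeries y * taylorSeries (fun x => dslope f 0 (y x)) := by
      rw [← taylorSeries_const, ← taylorSeries_mul hy hgy,
        ← taylorSeries_add analyticAt_const (hy.fun_mul hgy)]
      exact congrArg _ (funext fun x => hfg (y x))
    obtain ⟨R, hR⟩ := ih hg
    refine ⟨R, ?_⟩
    have h3 : ∀ m, PowerSeries.coeff (m + 1) (taylorSeries f) =
        PowerSeries.coeff m (taylorSeries (dslope f 0)) := fun m => by
      rw [h1, map_add, PowerSeries.coeff_C, if_neg (Nat.succ_ne_zero m), zero_add,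
        PowerSeries.coeff_succ_X_mul]
    have h0 : PowerSeries.coeff 0 (taylorSeries f) = f 0 := by
      rw [PowerSeries.coeff_zero_eq_constantCoeff_apply, constantCoeff_taylorSeries]
    rw [h2, Finset.sum_range_succ', hR, mul_add, Finset.mul_sum]
    simp only [h3, h0, pow_zero, mul_one, pow_succ]
    have h4 : ∀ m, taylorSeries y * (PowerSeries.C (PowerSeries.coeff m
        (taylorSeries (dslope f 0))) * taylorSeries y ^ m) = PowerSeries.C (PowerSeries.coeff m
        (taylorSeries (dslope f 0))) * (taylorSeries y ^ m * taylorSeries y) := fun m => by ring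
    simp only [h4]
    ring

/-- Cauchy's estimate for the coefficients of the Taylor series. -/
theorem norm_coeff_taylorSeries_le {f : ℂ → ℂ} {r C : ℝ} (hr : 0 < r)
    (hf : DiffContOnCl ℂ f (Metric.ball 0 r)) (hC : ∀ z ∈ Metric.sphere (0 : ℂ) r, ‖f z‖ ≤ C)
    (n : ℕ) : ‖PowerSeries.coeff n (taylorSeries f)‖ ≤ C / r ^ n := by
  have h := Complex.norm_iteratedDeriv_le_of_forall_mem_sphere_norm_le n hr hf hC
  have h0 : (0 : ℝ) < n.factorial := by exact_mod_cast n.factorial_pos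
  rw [coeff_taylorSeries, norm_mul, norm_inv, Complex.norm_natCast, inv_mul_le_iff₀ h0]
  exact h.trans_eq (by ring)

/-- The function `x ↦ x f(1 / x)`, continued by `1` to `x = 0`: the expansion of `f` at infinity in
the coordinate `x = 1 / z`, for `f` asymptotic to `z`. -/
noncomputable def atInfty (f : ℂ → ℂ) : ℂ → ℂ := Function.update (fun x => x * f x⁻¹) 0 1

theorem atInfty_zero (f : ℂ → ℂ) : atInfty f 0 = 1 := Function.update_self ..

theorem atInfty_of_ne (f : ℂ → ℂ) {x : ℂ} (hx : x ≠ 0) : atInfty f x = x * f x⁻¹ :=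
  Function.update_of_ne hx ..

theorem differentiableOn_atInfty {f : ℂ → ℂ} {r : ℝ} (hr : 0 < r)
    (hf : ∀ z : ℂ, r⁻¹ < ‖z‖ → DifferentiableAt ℂ f z)
    (h0 : Tendsto (atInfty f) (𝓝 0) (𝓝 1)) :
    DifferentiableOn ℂ (atInfty f) (Metric.ball 0 r) := by
  refine (Complex.differentiableOn_compl_singleton_and_continuousAt_iff
    (Metric.ball_mem_nhds 0 hr)).1 ⟨fun x hx => ?_, ?_⟩
  · have hx0 : x ≠ 0 := hx.2
    have hxr : ‖x‖ < r := by simpa using hx.1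
    have h1 : r⁻¹ < ‖x⁻¹‖ := by
      rw [norm_inv]
      exact inv_strictAnti₀ (norm_pos_iff.2 hx0) hxr
    have h2 : DifferentiableAt ℂ (fun x => x * f x⁻¹) x :=
      differentiableAt_id.mul ((hf _ h1).comp x (differentiableAt_inv hx0))
    refine (h2.congr_of_eventuallyEq ?_).differentiableWithinAt
    filter_upwards [isOpen_ne.mem_nhds hx0] with u hu using atInfty_of_ne f hu
  · rw [ContinuousAt, atInfty_zero]
    exact h0

theorem hasLaurentAtInfty_of_differentiableOn {f : ℂ → ℂ} {r : ℝ} (hr : 0 < r)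
    (hf : DifferentiableOn ℂ (atInfty f) (Metric.ball 0 r)) :
    HasLaurentAtInfty f fun l => PowerSeries.coeff (l + 1) (taylorSeries (atInfty f)) := by
  have hev : ∀ᶠ z in cobounded ℂ, z⁻¹ ∈ Metric.ball (0 : ℂ) r :=
    tendsto_inv₀_cobounded.eventually (Metric.ball_mem_nhds 0 hr)
  filter_upwards [hev, eventually_ne_cobounded 0] with z hz hz0
  have h1 := (hasSum_nat_add_iff' 1).2 (Complex.hasSum_taylorSeries_on_ball hf hz)
  have h2 := h1.mul_left z
  have h3 : z * (atInfty f z⁻¹ - ∑ i ∈ Finset.range 1, (i.factorial : ℂ)⁻¹ • (z⁻¹ - 0) ^ i •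
      iteratedDeriv i (atInfty f) 0) = f z - z := by
    rw [atInfty_of_ne f (inv_ne_zero hz0)]
    simp only [Finset.sum_range_one, iteratedDeriv_zero, atInfty_zero, inv_inv]
    simp
    field_simp
  rw [h3] at h2
  refine Eq.mp (congrArg (HasSum · (f z - z)) (funext fun l => ?_)) h2
  rw [coeff_taylorSeries]
  simp only [sub_zero, smul_eq_mul, pow_succ, inv_pow]
  field_simp

/-! ### Critical polynomials on the Mandelbrot set -/

/-- The polynomials `f_c^(n+1)(0)` in `c`, up to the sign for `n = 0`. -/
def critPoly : ℕ → ℂ → ℂ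
  | 0, c => c
  | n + 1, c => critPoly n c ^ 2 - c

theorem norm_critPoly (n : ℕ) (c : ℂ) : ‖critPoly n c‖ = ‖(quadFamily c)^[n + 1] 0‖ := by
  have h : critPoly n c ^ 2 = ((quadFamily c)^[n + 1] 0) ^ 2 := by
    induction n with
    | zero => simp [critPoly, quadFamily]
    | succ n ih => rw [Function.iterate_succ_apply', quadFamily, ← ih, critPoly]
  exact (sq_eq_sq₀ (norm_nonneg _) (norm_nonneg _)).1 (by rw [← norm_pow, h, norm_pow])

theorem continuous_critPoly (n : ℕ) : Continuous (critPoly n) := by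
  induction n with
  | zero => exact continuous_id
  | succ n ih => exact (ih.pow 2).sub continuous_id

/-- Escape criterion: a critical orbit that reaches modulus at least `4` and at least `‖c‖` is
unbounded. -/
theorem notMem_mandelbrotSet {c : ℂ} {n : ℕ} (h4 : 4 ≤ ‖critPoly n c‖)
    (hc : ‖c‖ ≤ ‖critPoly n c‖) : c ∉ mandelbrotSet := by
  have hgrow : ∀ k, ‖critPoly n c‖ * 3 ^ k ≤ ‖critPoly (n + k) c‖ := by
    intro k
    induction k with
    | zero => simp
    | succ k ih =>
      have h3 : (1 : ℝ) ≤ 3 ^ k := one_le_pow₀ (by norm_num)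
      have h1 : ‖critPoly (n + k) c‖ ^ 2 - ‖c‖ ≤ ‖critPoly (n + (k + 1)) c‖ := by
        rw [← norm_pow]; exact norm_sub_norm_le _ _
      have h2 : ‖critPoly n c‖ ≤ ‖critPoly (n + k) c‖ := by nlinarith
      rw [pow_succ]
      nlinarith
  rintro ⟨b, hb⟩
  obtain ⟨k, hk⟩ := pow_unbounded_of_one_lt b (by norm_num : (1 : ℝ) < 3)
  have h5 := hb ⟨n + k + 1, rfl⟩
  simp only [← norm_critPoly] at h5
  have h6 : (0 : ℝ) < 3 ^ k := by positivity
  nlinarith [hgrow k]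

theorem notMem_mandelbrotSet_of_four_le {c : ℂ} (hc : 4 ≤ ‖c‖) : c ∉ mandelbrotSet :=
  notMem_mandelbrotSet (n := 0) hc le_rfl

theorem notMem_mandelbrotSet_of_four_le_critPoly {c : ℂ} {n : ℕ} (h : 4 ≤ ‖critPoly n c‖) :
    c ∉ mandelbrotSet := by
  rcases le_total 4 ‖c‖ with hc | hc
  · exact notMem_mandelbrotSet_of_four_le hc
  · exact notMem_mandelbrotSet h (hc.trans h)

/-! ### The Riemann maps at infinity -/

namespace IsMandelbrotRiemannPair

variable {φ ψ : ℂ → ℂ}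

theorem one_lt_norm (h : IsMandelbrotRiemannPair φ ψ) {c : ℂ} (hc : c ∉ mandelbrotSet) :
    1 < ‖φ c‖ := h.conformal.mapsTo hc

theorem tendsto_atInfty (h : IsMandelbrotRiemannPair φ ψ) :
    Tendsto (atInfty φ) (𝓝 0) (𝓝 1) := by
  have h1 : Tendsto (atInfty φ) (𝓝[≠] 0) (𝓝 1) := by
    refine (h.normalized.comp tendsto_inv₀_nhdsNE_zero).congr' ?_
    filter_upwards [self_mem_nhdsWithin] with x hx
    rw [atInfty_of_ne φ hx, Function.comp_apply, div_inv_eq_mul, mul_comm]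
  have h2 : ContinuousAt (atInfty φ) 0 := by
    rw [continuousAt_iff_punctured_nhds, atInfty_zero]
    exact h1
  simpa [ContinuousAt, atInfty_zero] using h2

theorem differentiableOn_atInfty (h : IsMandelbrotRiemannPair φ ψ) :
    DifferentiableOn ℂ (atInfty φ) (Metric.ball 0 (1 / 4)) := by
  refine _root_.differentiableOn_atInfty (by norm_num) (fun z hz => ?_) h.tendsto_atInfty
  have hz : 4 < ‖z‖ := by simpa using hz
  refine h.conformal.holo.differentiableAt ?_
  filter_upwards [(isOpen_lt continuous_const continuous_norm).mem_nhds hz] with w hw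
  exact notMem_mandelbrotSet_of_four_le (le_of_lt hw)

theorem inv_notMem {x : ℂ} (hx : x ∈ Metric.ball (0 : ℂ) (1 / 4)) (hx0 : x ≠ 0) :
    x⁻¹ ∉ mandelbrotSet := by
  refine notMem_mandelbrotSet_of_four_le ?_
  have h1 : ‖x‖ < 1 / 4 := by simpa using hx
  rw [norm_inv]
  exact le_of_lt ((lt_inv_comm₀ (by norm_num) (norm_pos_iff.2 hx0)).2 (by linarith))

theorem atInfty_ne_zero (h : IsMandelbrotRiemannPair φ ψ) {x : ℂ}
    (hx : x ∈ Metric.ball (0 : ℂ) (1 / 4)) : atInfty φ x ≠ 0 := by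
  rcases eq_or_ne x 0 with rfl | hx0
  · rw [atInfty_zero]; exact one_ne_zero
  · rw [atInfty_of_ne φ hx0]
    refine mul_ne_zero hx0 (norm_pos_iff.1 ?_)
    exact zero_lt_one.trans (h.one_lt_norm (inv_notMem hx hx0))

theorem div_atInfty {x : ℂ} (hx0 : x ≠ 0) : x / atInfty φ x = (φ x⁻¹)⁻¹ := by
  rw [atInfty_of_ne φ hx0, div_mul_cancel_left₀ hx0]

theorem div_atInfty_mem_ball (h : IsMandelbrotRiemannPair φ ψ) {x : ℂ}
    (hx : x ∈ Metric.ball (0 : ℂ) (1 / 4)) : x / atInfty φ x ∈ Metric.ball (0 : ℂ) 1 := by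
  rcases eq_or_ne x 0 with rfl | hx0
  · simp
  · rw [div_atInfty hx0, mem_ball_zero_iff, norm_inv]
    exact inv_lt_one_of_one_lt₀ (h.one_lt_norm (inv_notMem hx hx0))

theorem atInfty_inverse (h : IsMandelbrotRiemannPair φ ψ) {x : ℂ}
    (hx : x ∈ Metric.ball (0 : ℂ) (1 / 4)) :
    atInfty ψ (x / atInfty φ x) = (atInfty φ x)⁻¹ := by
  rcases eq_or_ne x 0 with rfl | hx0
  · simp [atInfty_zero]
  · have hne : x / atInfty φ x ≠ 0 := div_ne_zero hx0 (h.atInfty_ne_zero hx)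
    rw [atInfty_of_ne ψ hne]
    rw [show (x / atInfty φ x)⁻¹ = φ x⁻¹ by rw [div_atInfty hx0, inv_inv],
      h.conformal.invOn.1 (inv_notMem hx hx0)]
    field_simp

theorem analyticAt_atInfty (h : IsMandelbrotRiemannPair φ ψ) : AnalyticAt ℂ (atInfty φ) 0 :=
  h.differentiableOn_atInfty.analyticAt (Metric.ball_mem_nhds 0 (by norm_num))

theorem analyticAt_div_atInfty (h : IsMandelbrotRiemannPair φ ψ) :
    AnalyticAt ℂ (fun x => x / atInfty φ x) 0 :=
  AnalyticAt.fun_div analyticAt_id h.analyticAt_atInfty (by rw [atInfty_zero]; exact one_ne_zero)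

/-- `ψ(w) / w → 1` as `w → ∞`. By the open mapping theorem, `x ↦ 1 / φ(1 / x)` covers a
neighbourhood of `0` by values at small `x`, where `ψ` is controlled by `φ`. -/
theorem tendsto_atInfty_inverse (h : IsMandelbrotRiemannPair φ ψ) :
    Tendsto (atInfty ψ) (𝓝 0) (𝓝 1) := by
  have hball : Metric.ball (0 : ℂ) (1 / 4) ∈ 𝓝 0 := Metric.ball_mem_nhds 0 (by norm_num)
  have hopen := h.analyticAt_div_atInfty.eventually_constant_or_nhds_le_map_nhds.resolve_left (by
    intro hconst
    have h1 : ∀ᶠ x in 𝓝[≠] (0 : ℂ), False := by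
      filter_upwards [hconst.filter_mono nhdsWithin_le_nhds, mem_nhdsWithin_of_mem_nhds hball,
        self_mem_nhdsWithin] with x hx hxb hx0
      rw [zero_div] at hx
      exact div_ne_zero hx0 (h.atInfty_ne_zero hxb) hx
    exact h1.exists.elim fun _ => id)
  rw [zero_div] at hopen
  refine Tendsto.mono_left (tendsto_map'_iff.2 ?_) hopen
  have h2 : Tendsto (fun x => (atInfty φ x)⁻¹) (𝓝 0) (𝓝 1) := by
    simpa using h.tendsto_atInfty.inv₀ one_ne_zero
  refine h2.congr' ?_
  filter_upwards [hball] with x hx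
  rw [Function.comp_apply, h.atInfty_inverse hx]

theorem differentiableOn_atInfty_inverse (h : IsMandelbrotRiemannPair φ ψ) :
    DifferentiableOn ℂ (atInfty ψ) (Metric.ball 0 1) := by
  refine _root_.differentiableOn_atInfty one_pos (fun z hz => ?_) h.tendsto_atInfty_inverse
  have hz : 1 < ‖z‖ := by simpa using hz
  exact h.conformal.holo_inv.differentiableAt
    ((isOpen_lt continuous_const continuous_norm).mem_nhds hz)

end IsMandelbrotRiemannPair

/-! ### The maximum principle and the formal limit -/

/-- The function `u ^ (2ⁿ) critPoly n (ψ (1 / u))`, written so that it is analytic at `u = 0` when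
`D = atInfty ψ` is. -/
noncomputable def critQuotient (D : ℂ → ℂ) : ℕ → ℂ → ℂ
  | 0, u => D u
  | n + 1, u => critQuotient D n u ^ 2 - u ^ (2 ^ (n + 1) - 1) * D u

theorem differentiableOn_critQuotient {D : ℂ → ℂ} {s : Set ℂ} (hD : DifferentiableOn ℂ D s)
    (n : ℕ) : DifferentiableOn ℂ (critQuotient D n) s := by
  induction n with
  | zero => exact hD
  | succ n ih => exact (ih.pow 2).sub ((differentiableOn_id.pow _).mul hD)

theorem critQuotient_atInfty (ψ : ℂ → ℂ) (n : ℕ) {u : ℂ} (hu : u ≠ 0) :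
    critQuotient (atInfty ψ) n u = u ^ 2 ^ n * critPoly n (ψ u⁻¹) := by
  induction n with
  | zero => simp [critQuotient, critPoly, atInfty_of_ne ψ hu]
  | succ n ih =>
    rw [critQuotient, critPoly, ih, atInfty_of_ne ψ hu, ← mul_assoc, ← pow_succ,
      Nat.sub_add_cancel Nat.one_le_two_pow, pow_succ 2 n, pow_mul]
    ring

/-- The polynomial function with Taylor series `critSeries n`. -/
def critFun : ℕ → ℂ → ℂ
  | 0, _ => 1
  | n + 1, x => critFun n x ^ 2 - x ^ (2 ^ (n + 1) - 1)

theorem analyticAt_critFun (n : ℕ) (x : ℂ) : AnalyticAt ℂ (critFun n) x := by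
  induction n with
  | zero => exact analyticAt_const
  | succ n ih => exact (ih.fun_pow 2).fun_sub (analyticAt_id.fun_pow _)

theorem taylorSeries_critFun (n : ℕ) :
    taylorSeries (critFun n) = PowerSeries.map (Int.castRingHom ℂ) (critSeries n) := by
  induction n with
  | zero =>
    have h0 : critFun 0 = fun _ => 1 := rfl
    rw [h0, taylorSeries_const, critSeries, map_one, map_one]
  | succ n ih =>
    have hid : AnalyticAt ℂ (fun x : ℂ => x) 0 := analyticAt_id
    have h1 : taylorSeries (fun x => critFun (n + 1) x + x ^ (2 ^ (n + 1) - 1)) =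
        taylorSeries (fun x => critFun n x ^ 2) :=
      congrArg _ (funext fun x => by rw [critFun]; ring)
    rw [taylorSeries_add (analyticAt_critFun _ 0) (hid.fun_pow _), taylorSeries_pow hid,
      taylorSeries_id, taylorSeries_pow (analyticAt_critFun n 0), ih] at h1
    rw [eq_sub_of_add_eq h1, critSeries]
    simp

theorem critQuotient_mul_pow {D : ℂ → ℂ} {x g : ℂ} (hg : g ≠ 0) (hD : D (x / g) = g⁻¹) (n : ℕ) :
    critQuotient D n (x / g) * g ^ 2 ^ n = critFun n x := by
  induction n with
  | zero => rw [critQuotient, critFun, hD, pow_zero, pow_one, inv_mul_cancel₀ hg]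
  | succ n ih =>
    rw [critQuotient, critFun, ← ih, hD, div_pow]
    obtain ⟨k, hk⟩ := Nat.exists_eq_add_of_le' (Nat.one_le_two_pow (n := n + 1))
    have hk2 : (g ^ 2 ^ n) ^ 2 = g ^ k * g := by rw [← pow_mul, ← pow_succ 2 n, hk, pow_succ]
    rw [hk, Nat.add_sub_cancel, mul_pow, hk2, pow_succ]
    field_simp
    ring

namespace IsMandelbrotRiemannPair

variable {φ ψ : ℂ → ℂ}

/-- Near the unit circle `ψ` takes values close to the Mandelbrot set, where the `critPoly n` are
bounded by `4`. -/
theorem exists_norm_critPoly_lt (h : IsMandelbrotRiemannPair φ ψ) (n : ℕ) :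
    ∃ ρ > 1, ∀ w : ℂ, 1 < ‖w‖ → ‖w‖ < ρ → ‖critPoly n (ψ w)‖ < 4 := by
  have h1 : ∀ᶠ c in cobounded ℂ, 2 ≤ ‖φ c‖ := by
    have h2 : ∀ᶠ c in cobounded ℂ, 1 / 2 < ‖φ c / c‖ :=
      h.normalized.norm.eventually (lt_mem_nhds (by norm_num))
    filter_upwards [h2, tendsto_norm_cobounded_atTop.eventually_ge_atTop 4] with c hc hc4
    rw [norm_div, lt_div_iff₀ (by linarith)] at hc
    linarith
  obtain ⟨R, -, hR⟩ := (hasBasis_cobounded_norm (E := ℂ)).eventually_iff.1 h1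
  let K : Set ℂ := Metric.closedBall 0 R ∩ {c | 4 ≤ ‖critPoly n c‖}
  have hK : IsCompact K := (isCompact_closedBall 0 R).inter_right
    (isClosed_le continuous_const (continuous_critPoly n).norm)
  have hKM : ∀ c ∈ K, c ∉ mandelbrotSet := fun c hc =>
    notMem_mandelbrotSet_of_four_le_critPoly hc.2
  obtain ⟨m, hm1, hm⟩ : ∃ m > 1, ∀ c ∈ K, m ≤ ‖φ c‖ := by
    rcases K.eq_empty_or_nonempty with hE | hne
    · exact ⟨2, by norm_num, by simp [hE]⟩
    · obtain ⟨c, hc, hmin⟩ := hK.exists_isMinOn hne (f := fun c => ‖φ c‖)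
        ((h.conformal.holo.continuousOn.mono hKM).norm)
      exact ⟨‖φ c‖, h.one_lt_norm (hKM c hc), fun c' hc' => hmin hc'⟩
  refine ⟨min 2 m, lt_min one_lt_two hm1, fun w hw hwρ => ?_⟩
  by_contra! hge
  have hφψ : φ (ψ w) = w := h.conformal.invOn.2 hw
  rcases le_total R ‖ψ w‖ with hle | hle
  · have := hR hle
    rw [hφψ] at this
    exact absurd (hwρ.trans_le (min_le_left _ _)) (not_lt.2 this)
  · have := hm (ψ w) ⟨by simpa using hle, hge⟩
    rw [hφψ] at this
    exact absurd (hwρ.trans_le (min_le_right _ _)) (not_lt.2 this)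

/-- The maximum principle on the disk `‖u‖ < 1`, that is, outside the Mandelbrot set. -/
theorem norm_critQuotient_le (h : IsMandelbrotRiemannPair φ ψ) (n : ℕ) {u : ℂ}
    (hu : u ∈ Metric.ball (0 : ℂ) 1) : ‖critQuotient (atInfty ψ) n u‖ ≤ 4 := by
  obtain ⟨ρ, hρ1, hρ⟩ := h.exists_norm_critPoly_lt n
  have hu1 : ‖u‖ < 1 := by simpa using hu
  obtain ⟨r, hr, hr1⟩ := exists_between (max_lt hu1 (inv_lt_one_of_one_lt₀ hρ1))
  have hur : ‖u‖ < r := (le_max_left _ _).trans_lt hr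
  have hρr : ρ⁻¹ < r := (le_max_right _ _).trans_lt hr
  have hr0 : 0 < r := (norm_nonneg u).trans_lt hur
  have hd : DifferentiableOn ℂ (critQuotient (atInfty ψ) n) (Metric.ball 0 1) :=
    differentiableOn_critQuotient h.differentiableOn_atInfty_inverse n
  refine Complex.norm_le_of_forall_mem_frontier_norm_le (U := Metric.ball 0 r)
    Metric.isBounded_ball ?_ (fun z hz => ?_) (subset_closure (by simpa using hur))
  · exact (hd.mono (Metric.closure_ball_subset_closedBall.trans
      (Metric.closedBall_subset_ball hr1))).diffContOnCl
  · rw [frontier_ball _ hr0.ne', mem_sphere_zero_iff_norm] at hz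
    have hz0 : z ≠ 0 := norm_pos_iff.1 (hz ▸ hr0)
    rw [critQuotient_atInfty ψ n hz0, norm_mul, norm_pow, hz]
    have h1 := hρ z⁻¹ (by rw [norm_inv, hz]; exact (one_lt_inv₀ hr0).2 hr1)
      (by rw [norm_inv, hz]; exact inv_lt_of_inv_lt₀ (by linarith) hρr)
    have h2 : r ^ 2 ^ n ≤ 1 := pow_le_one₀ hr0.le hr1.le
    nlinarith [norm_nonneg (critPoly n (ψ z⁻¹)), pow_nonneg hr0.le (2 ^ n)]

/-- `φ` at infinity is the formal limit of the roots of the polynomials `f_c^(n+1)(0)`. -/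
theorem coeff_taylorSeries_atInfty (h : IsMandelbrotRiemannPair φ ψ) (m : ℕ) :
    PowerSeries.coeff m (taylorSeries (atInfty φ)) = PowerSeries.coeff m (critRoot m) := by
  have hdy : DifferentiableOn ℂ (fun x => x / atInfty φ x) (Metric.ball 0 (1 / 4)) :=
    differentiableOn_id.div h.differentiableOn_atInfty fun x hx => h.atInfty_ne_zero hx
  have hdiff : ∀ n, DifferentiableOn ℂ
      (fun x => critQuotient (atInfty ψ) n (x / atInfty φ x)) (Metric.ball 0 (1 / 4)) := fun n =>
    (differentiableOn_critQuotient h.differentiableOn_atInfty_inverse n).comp hdy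
      fun x hx => h.div_atInfty_mem_ball hx
  have hball : Metric.ball (0 : ℂ) (1 / 4) ∈ 𝓝 0 := Metric.ball_mem_nhds 0 (by norm_num)
  have hsub : Metric.closedBall (0 : ℂ) (1 / 8) ⊆ Metric.ball 0 (1 / 4) :=
    Metric.closedBall_subset_ball (by norm_num)
  refine coeff_eq_coeff_critRoot
    (h := fun n => taylorSeries fun x => critQuotient (atInfty ψ) n (x / atInfty φ x))
    (K := fun m => 4 / (1 / 8) ^ m) ?_ (fun n => ?_) (fun n m => ?_) m
  · rw [constantCoeff_taylorSeries, atInfty_zero]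
  · rw [← taylorSeries_critFun, ← taylorSeries_pow h.analyticAt_atInfty,
      ← taylorSeries_mul ((hdiff n).analyticAt hball) (h.analyticAt_atInfty.fun_pow _)]
    refine taylorSeries_congr ?_
    filter_upwards [hball] with x hx
    exact critQuotient_mul_pow (h.atInfty_ne_zero hx) (h.atInfty_inverse hx) n
  · refine norm_coeff_taylorSeries_le (by norm_num)
      ((hdiff n).mono (Metric.closure_ball_subset_closedBall.trans hsub)).diffContOnCl (fun z hz => ?_) m
    exact h.norm_critQuotient_le n
      (h.div_atInfty_mem_ball (hsub (Metric.sphere_subset_closedBall hz)))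

/-- `ψ ∘ φ = id` at infinity, on the level of formal series. -/
theorem isFormalComp_inverse (h : IsMandelbrotRiemannPair φ ψ) :
    IsFormalComp (fun m => PowerSeries.coeff m (taylorSeries (atInfty ψ)))
      (PowerSeries.X * (taylorSeries (atInfty φ))⁻¹) (taylorSeries (atInfty φ))⁻¹ := by
  have hball : Metric.ball (0 : ℂ) (1 / 4) ∈ 𝓝 0 := Metric.ball_mem_nhds 0 (by norm_num)
  have hψ : AnalyticAt ℂ (atInfty ψ) 0 :=
    h.differentiableOn_atInfty_inverse.analyticAt (Metric.ball_mem_nhds 0 one_pos)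
  have hφ := h.analyticAt_atInfty
  have hy := h.analyticAt_div_atInfty
  have hc : AnalyticAt ℂ (fun x => atInfty ψ (x / atInfty φ x)) 0 :=
    AnalyticAt.fun_comp (by rwa [zero_div]) hy
  have hne : PowerSeries.constantCoeff (taylorSeries (atInfty φ)) ≠ 0 := by
    rw [constantCoeff_taylorSeries, atInfty_zero]; exact one_ne_zero
  have h1 : taylorSeries (fun x => x / atInfty φ x) =
      PowerSeries.X * (taylorSeries (atInfty φ))⁻¹ := by
    rw [PowerSeries.eq_mul_inv_iff_mul_eq hne, ← taylorSeries_mul hy hφ, ← taylorSeries_id]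
    refine taylorSeries_congr ?_
    filter_upwards [hball] with x hx using div_mul_cancel₀ x (h.atInfty_ne_zero hx)
  have h2 : taylorSeries (fun x => atInfty ψ (x / atInfty φ x)) =
      (taylorSeries (atInfty φ))⁻¹ := by
    rw [PowerSeries.eq_inv_iff_mul_eq_one hne, ← taylorSeries_mul hc hφ,
      ← map_one (PowerSeries.C (R := ℂ)), ← taylorSeries_const]
    refine taylorSeries_congr ?_
    filter_upwards [hball] with x hx
    rw [h.atInfty_inverse hx, inv_mul_cancel₀ (h.atInfty_ne_zero hx)]
  rw [← h1, ← h2]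
  exact isFormalComp_taylorSeries hψ hy (zero_div _)

end IsMandelbrotRiemannPair

/-! ### Exponents of two in the Laurent coefficients -/

theorem hasDyadicExponent_of_odd {z : ℂ} {e : ℕ} (h : ∃ a : ℤ, Odd a ∧ z * 2 ^ e = a) :
    HasDyadicExponent z e := by
  obtain ⟨a, ha, hz⟩ := h
  refine ⟨a, ha, ?_⟩
  rw [← hz, zpow_natCast]
  field_simp

theorem HasDyadicExponent.ne_zero {z : ℂ} {e : ℤ} (h : HasDyadicExponent z e) : z ≠ 0 := by
  obtain ⟨a, ha, rfl⟩ := h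
  refine div_ne_zero (Int.cast_ne_zero.2 ?_) (zpow_ne_zero _ two_ne_zero)
  rintro rfl
  exact absurd ha (by decide)

theorem theorem3 (φ ψ : ℂ → ℂ) (h : IsMandelbrotRiemannPair φ ψ) :
    ∃ B C : ℕ → ℂ, HasLaurentAtInfty φ B ∧ HasLaurentAtInfty ψ C ∧
      ∀ l : ℕ, Odd l →
        (∃ p q : ℤ, HasDyadicExponent (B l) p ∧ HasDyadicExponent (C l) q ∧
          q = p ∧ p = (l : ℤ) + 1 + (padicValNat 2 (Nat.factorial (l + 1)) : ℤ)) ∧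
        C l ≠ 0 := by
  refine ⟨_, _, hasLaurentAtInfty_of_differentiableOn (by norm_num) h.differentiableOn_atInfty,
    hasLaurentAtInfty_of_differentiableOn one_pos h.differentiableOn_atInfty_inverse,
    fun l hl => ?_⟩
  obtain ⟨hB, hC⟩ := odd_coeff_of_coeff_eq_critRoot h.coeff_taylorSeries_atInfty
    h.isFormalComp_inverse hl
  exact ⟨⟨dyadicWeight (l + 1), dyadicWeight (l + 1), hasDyadicExponent_of_odd hB,
    hasDyadicExponent_of_odd hC, rfl, by simp [dyadicWeight]⟩,
    (hasDyadicExponent_of_odd hC).ne_zero⟩
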